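/- **Lemma (asymptotic smoothing factor for semi-coarsening in time).** Let $p_t \ge 0$ be an integer and let $R = P/Q$ be the $(p_t, p_t+1)$ subdiagonal Padé approximation of $e^z$; that is, $P$ and $Q$ are real polynomials with $\deg P \le p_t$, $\deg Q \le p_t + 1$, $Q(0) = 1$ and $Q(z)\,e^z - P(z) = O(z^{2p_t+2})$ as $z \to 0$. Let $\mu \ge 0$ and, for $\theta_x \in [0,\pi]$, put $$\beta(\theta_x) := 6\,\frac{1-\cos\theta_x}{2+\cos\theta_x}, \qquad \alpha(\theta_x,\mu) := R(-\mu\,\beta(\theta_x)).$$ For real $\omega_t$, $\alpha$, $\theta_t$ let $\hat{\mathcal S}(\omega_t,\alpha,\theta_t) \ge 0$ be given by $$\hat{\mathcal S}(\omega_t,\alpha,\theta_t)^2 := (1-\omega_t)^2 + 2\,\omega_t(1-\omega_t)\,\alpha\cos\theta_t + \alpha^2\omega_t^2 .$$ Then $Q(-\mu\,\beta(\theta_x)) \ne 0$ for all $\theta_x \in [0,\pi]$, so that $\alpha(\theta_x,\mu)$ is well defined, and for the damping parameter $\omega_t = \tfrac12$ the supremum below is finite and satisfies $$\sup_{\theta_t\in[\pi/2,\pi],\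 \theta_x\in[0,\pi]} \hat{\mathcal S}\bigl(\tfrac12,\,\alpha(\theta_x,\mu),\,\theta_t\bigr) \;\le\; \frac{1}{\sqrt2}.$$ -/

import Mathlib

open scoped Polynomial PowerSeries

/-- The pair `(P, Q)` of real polynomials, with the usual normalization `Q(0) = 1`, is the `(m, n)`
Padé approximation `P / Q` of the formal power series `f`: `P` has degree at most `m`, `Q` has
degree at most `n`, and `Q(z) f(z) - P(z) = O(z ^ (m + n + 1))`. -/
structure IsPadeApproximation (f : ℝ⟦X⟧) (m n : ℕ) (P Q : ℝ[X]) : Prop where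
  natDegree_num_le : P.natDegree ≤ m
  natDegree_den_le : Q.natDegree ≤ n
  den_eval_zero : Q.eval 0 = 1
  order : (PowerSeries.X : ℝ⟦X⟧) ^ (m + n + 1) ∣ (Q : ℝ⟦X⟧) * f - (P : ℝ⟦X⟧)

/-- Subdiagonal Padé approximations of the exponential function exist in every degree. -/
theorem exists_isPadeApproximation_exp (p : ℕ) :
    ∃ P Q : ℝ[X], IsPadeApproximation (PowerSeries.exp ℝ) p (p + 1) P Q := by
  classical
  set q : ℕ → ℝ := fun j =>
    (-1 : ℝ) ^ j * ((p + 1).choose j : ℝ) * ((2 * p + 1 - j).factorial : ℝ) /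
      ((2 * p + 1).factorial : ℝ) with hq
  set Q : ℝ[X] := ∑ j ∈ Finset.range (p + 2), Polynomial.C (q j) * Polynomial.X ^ j with hQ
  have hcoeff : ∀ i, Q.coeff i = if i < p + 2 then q i else 0 := by
    intro i
    simp [hQ, Polynomial.finsetSum_coeff, Polynomial.coeff_X_pow]
  refine ⟨PowerSeries.trunc (p + 1) ((Q : ℝ⟦X⟧) * PowerSeries.exp ℝ), Q, ?_, ?_, ?_, ?_⟩
  · exact Nat.lt_succ_iff.mp (PowerSeries.natDegree_trunc_lt _ _)
  · refine Polynomial.natDegree_le_iff_coeff_eq_zero.mpr fun i hi => ?_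
    rw [hcoeff, if_neg (by omega)]
  · rw [← Polynomial.coeff_zero_eq_eval_zero, hcoeff, if_pos (by omega)]
    have : ((2 * p + 1).factorial : ℝ) ≠ 0 := by positivity
    simp [hq, this]
  · rw [PowerSeries.X_pow_dvd_iff]
    intro i hi
    rw [map_sub, Polynomial.coeff_coe, PowerSeries.coeff_trunc]
    by_cases hip : i < p + 1
    · simp [hip]
    rw [if_neg hip, sub_zero]
    obtain ⟨d, hd⟩ : ∃ d, i + d = 2 * p + 1 := ⟨2 * p + 1 - i, by omega⟩
    set D : ℝ[X] := (descPochhammer ℝ d).comp (Polynomial.C ((2 * p + 1 : ℕ) : ℝ) - Polynomial.X)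
      with hD
    have hdeg : D.natDegree < p + 1 := by
      have h1 : (Polynomial.C ((2 * p + 1 : ℕ) : ℝ) - Polynomial.X).natDegree ≤ 1 := by
        compute_degree
      have h2 : D.natDegree ≤ (descPochhammer ℝ d).natDegree * 1 :=
        Polynomial.natDegree_comp_le.trans (Nat.mul_le_mul_left _ h1)
      rw [descPochhammer_natDegree] at h2
      omega
    have heval : ∀ j ∈ Finset.range (p + 2),
        D.eval (j : ℝ) = ((2 * p + 1 - j).factorial : ℝ) / ((i - j).factorial : ℝ) := by
      intro j hj
      have hj' : j < p + 2 := Finset.mem_range.mp hj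
      have h1 : D.eval (j : ℝ) = (((2 * p + 1 - j).descFactorial d : ℕ) : ℝ) := by
        rw [← descPochhammer_eval_eq_descFactorial, Nat.cast_sub (by omega)]
        simp [hD]
      rw [h1, eq_div_iff (by positivity)]
      have h2 := Nat.factorial_mul_descFactorial (n := 2 * p + 1 - j) (k := d) (by omega)
      rw [show 2 * p + 1 - j - d = i - j by omega] at h2
      rw [← h2]
      push_cast
      ring
    have hzero := congrFun (Polynomial.fwdDiff_iter_eq_zero_of_degree_lt hdeg) 0
    rw [fwdDiff_iter_eq_sum_shift] at hzero
    have hsum : PowerSeries.coeff i ((Q : ℝ⟦X⟧) * PowerSeries.exp ℝ) =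
        ∑ j ∈ Finset.range (p + 2), q j / ((i - j).factorial : ℝ) := by
      rw [PowerSeries.coeff_mul, Finset.Nat.sum_antidiagonal_eq_sum_range_succ_mk]
      simp only [Polynomial.coeff_coe, PowerSeries.coeff_exp, hcoeff]
      rw [← Finset.sum_subset (s₁ := Finset.range (p + 2))]
      · refine Finset.sum_congr rfl fun j hj => ?_
        rw [if_pos (Finset.mem_range.mp hj)]
        simp [div_eq_mul_inv]
      · intro j hj
        simp only [Finset.mem_range] at hj ⊢
        omega
      · intro j _ hj
        rw [if_neg (by simpa using hj), zero_mul]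
    rw [hsum]
    have hscale : ∑ j ∈ Finset.range (p + 2), q j / ((i - j).factorial : ℝ) =
        (-1 : ℝ) ^ (p + 1) / ((2 * p + 1).factorial : ℝ) *
          ∑ k ∈ Finset.range (p + 1 + 1),
            ((-1 : ℤ) ^ (p + 1 - k) * ((p + 1).choose k : ℤ)) • D.eval (0 + k • (1 : ℝ)) := by
      rw [Finset.mul_sum]
      refine Finset.sum_congr rfl fun j hj => ?_
      have hj' : j < p + 2 := Finset.mem_range.mp hj
      have hsign : (-1 : ℝ) ^ j = (-1) ^ (p + 1) * (-1) ^ (p + 1 - j) := by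
        obtain ⟨e, he⟩ : ∃ e, p + 1 = j + e := ⟨p + 1 - j, by omega⟩
        rw [he, Nat.add_sub_cancel_left, pow_add, mul_assoc, ← pow_add, ← two_mul, pow_mul]
        simp
      rw [zero_add, nsmul_one, heval j hj, zsmul_eq_mul]
      simp only [hq, hsign]
      push_cast
      ring
    rw [hscale]
    simpa using Or.inr hzero

/-- The function `β(θ) = 6 (1 - cos θ) / (2 + cos θ)`, with values in `[0, 12]`. -/
noncomputable def spatialSymbol (θ : ℝ) : ℝ :=
  6 * ((1 - Real.cos θ) / (2 + Real.cos θ))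

/-- The value `α(θ_x, μ) = R(-μ β(θ_x))` for the rational function `R = P / Q`. -/
noncomputable def stabilityValue (P Q : ℝ[X]) (θx μ : ℝ) : ℝ :=
  P.eval (-μ * spatialSymbol θx) / Q.eval (-μ * spatialSymbol θx)

/-- The nonnegative function `Ŝ` with
`Ŝ(ω, α, θ)² = (1 - ω)² + 2 ω (1 - ω) α cos θ + α² ω²`. -/
noncomputable def smoothingSymbol (ω α θ : ℝ) : ℝ :=
  Real.sqrt ((1 - ω) ^ 2 + 2 * ω * (1 - ω) * α * Real.cos θ + α ^ 2 * ω ^ 2)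

/-- The radicand is nonnegative, so that the defining equation for the square of `Ŝ` holds. -/
theorem smoothingSymbol_sq (ω α θ : ℝ) :
    smoothingSymbol ω α θ ^ 2 =
      (1 - ω) ^ 2 + 2 * ω * (1 - ω) * α * Real.cos θ + α ^ 2 * ω ^ 2 := by
  refine Real.sq_sqrt ?_
  have h : (1 - ω) ^ 2 + 2 * ω * (1 - ω) * α * Real.cos θ + α ^ 2 * ω ^ 2 =
      (1 - ω + ω * α * Real.cos θ) ^ 2 + (ω * α * Real.sin θ) ^ 2 := by
    rw [mul_pow _ (Real.sin θ), Real.sin_sq]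
    ring
  rw [h]
  positivity

/-- The values of `Ŝ(ω, α(θ_x, μ), θ_t)` over the frequencies `θ_t ∈ [π/2, π]`, `θ_x ∈ [0, π]`. -/
def semiCoarseningValues (P Q : ℝ[X]) (ω μ : ℝ) : Set ℝ :=
  {s | ∃ θt ∈ Set.Icc (Real.pi / 2) Real.pi, ∃ θx ∈ Set.Icc 0 Real.pi,
    s = smoothingSymbol ω (stabilityValue P Q θx μ) θt}

/-! Uniqueness of the Padé pair (`IsPadeApproximation.unique_exp`) reduces everything to explicit P
and Q. For x = μβ(θ_x) ≥ 0, expanding and integrating termwise gives (2p+1)! Q(-x) = ∫₀^∞ e^{-s} s^p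
(s+x)^{p+1} ds and (2p+1)! P(-x) = ∫₀^∞ e^{-s} s^{p+1} (s-x)^p ds. Comparing the integrands
pointwise yields Q(-x) > 0 and -1/8 ≤ α ≤ 1. At ω_t = 1/2, 4Ŝ² = 1 + 2α cos θ_t + α² with cos θ_t ∈
[-1,0]. This is at most 1 + α² ≤ 2 if α ≥ 0, and at most (1+|α|)² ≤ (9/8)² < 2 if α ≤ 0. -/

/-! ### The explicit Padé pair -/

/-- An alternating Vandermonde-type identity. -/
theorem alternating_sum_choose_mul_choose (n M d i : ℕ) (h : d + i = n + M) :
    ∑ j ∈ Finset.range (n + 1), (-1 : ℝ) ^ j * (n.choose j : ℝ) * ((n + M - j).choose d : ℝ) =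
      (M.choose i : ℝ) := by
  induction n generalizing M d i with
  | zero =>
    simp only [zero_add] at h
    subst h
    simpa using Nat.choose_symm_add
  | succ n ih =>
    -- Pascal's rule on `(n + 1).choose j` splits the sum into the cases (n, M+1) and (n, M);
    -- Pascal's rule on the right-hand sides closes the induction.
    have key : ∑ j ∈ Finset.range (n + 1 + 1),
          (-1 : ℝ) ^ j * ((n + 1).choose j : ℝ) * ((n + 1 + M - j).choose d : ℝ) =
        ∑ j ∈ Finset.range (n + 1),
          (-1 : ℝ) ^ j * (n.choose j : ℝ) * ((n + (M + 1) - j).choose d : ℝ) -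
        ∑ j ∈ Finset.range (n + 1),
          (-1 : ℝ) ^ j * (n.choose j : ℝ) * ((n + M - j).choose d : ℝ) := by
      have h1 : ∑ j ∈ Finset.range (n + 1),
            (-1 : ℝ) ^ j * (n.choose j : ℝ) * ((n + (M + 1) - j).choose d : ℝ) =
          ∑ j ∈ Finset.range (n + 1 + 1),
            (-1 : ℝ) ^ j * (n.choose j : ℝ) * ((n + 1 + M - j).choose d : ℝ) := by
        rw [Finset.sum_range_succ _ (n + 1), Nat.choose_succ_self]
        simp [add_assoc, add_comm M 1]
      rw [h1, Finset.sum_range_succ' _ (n + 1), Finset.sum_range_succ' _ (n + 1), sub_eq_add_neg,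
        add_right_comm (Finset.sum _ _), ← Finset.sum_neg_distrib, ← Finset.sum_add_distrib]
      congr 1
      · refine Finset.sum_congr rfl fun j _ => ?_
        rw [Nat.choose_succ_succ, show n + 1 + M - (j + 1) = n + M - j by omega]
        push_cast
        ring
      · simp
    rw [key, ih (M + 1) d i (by omega)]
    rcases i with _ | i
    · rw [Finset.sum_eq_zero]
      · simp
      · intro j _
        rw [Nat.choose_eq_zero_of_lt (by omega : n + M - j < d)]
        simp
    · rw [ih M d i (by omega), Nat.choose_succ_succ]
      push_cast
      ring

/-- The numerator of the `(p, p + 1)` Padé approximation of the exponential function. -/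
noncomputable def expPadeNum (p : ℕ) : ℝ[X] :=
  ∑ j ∈ Finset.range (p + 1),
    Polynomial.C ((p.choose j : ℝ) * ((2 * p + 1 - j).factorial : ℝ) /
      ((2 * p + 1).factorial : ℝ)) * Polynomial.X ^ j

/-- The denominator of the `(p, p + 1)` Padé approximation of the exponential function. -/
noncomputable def expPadeDen (p : ℕ) : ℝ[X] :=
  ∑ j ∈ Finset.range (p + 2),
    Polynomial.C ((-1 : ℝ) ^ j * ((p + 1).choose j : ℝ) * ((2 * p + 1 - j).factorial : ℝ) /
      ((2 * p + 1).factorial : ℝ)) * Polynomial.X ^ j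

theorem coeff_expPadeNum (p i : ℕ) :
    (expPadeNum p).coeff i =
      (p.choose i : ℝ) * ((2 * p + 1 - i).factorial : ℝ) / ((2 * p + 1).factorial : ℝ) := by
  simp only [expPadeNum, Polynomial.finsetSum_coeff, Polynomial.coeff_C_mul_X_pow,
    Finset.sum_ite_eq, Finset.mem_range]
  split_ifs with h
  · rfl
  · rw [Nat.choose_eq_zero_of_lt (by omega)]
    simp

theorem coeff_expPadeDen (p i : ℕ) :
    (expPadeDen p).coeff i =
      (-1 : ℝ) ^ i * ((p + 1).choose i : ℝ) * ((2 * p + 1 - i).factorial : ℝ) /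
        ((2 * p + 1).factorial : ℝ) := by
  simp only [expPadeDen, Polynomial.finsetSum_coeff, Polynomial.coeff_C_mul_X_pow,
    Finset.sum_ite_eq, Finset.mem_range]
  split_ifs with h
  · rfl
  · rw [Nat.choose_eq_zero_of_lt (by omega)]
    simp

/-- By the alternating identity with n = p+1, M = p, the coefficient of z^i in Q e^z for i ≤ 2p+1 is
C(p,i)(2p+1-i)!/(2p+1)!. This is the numerator's coefficient, and it vanishes for p < i. -/
theorem isPadeApproximation_expPade (p : ℕ) :
    IsPadeApproximation (PowerSeries.exp ℝ) p (p + 1) (expPadeNum p) (expPadeDen p) := by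
  have hfac : ((2 * p + 1).factorial : ℝ) ≠ 0 := by positivity
  refine ⟨?_, ?_, ?_, ?_⟩
  · refine Polynomial.natDegree_le_iff_coeff_eq_zero.mpr fun i hi => ?_
    rw [coeff_expPadeNum, Nat.choose_eq_zero_of_lt hi]
    simp
  · refine Polynomial.natDegree_le_iff_coeff_eq_zero.mpr fun i hi => ?_
    rw [coeff_expPadeDen, Nat.choose_eq_zero_of_lt hi]
    simp
  · rw [← Polynomial.coeff_zero_eq_eval_zero, coeff_expPadeDen]
    simp [hfac]
  · rw [PowerSeries.X_pow_dvd_iff]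
    intro i hi
    obtain ⟨d, hd⟩ : ∃ d, d + i = p + 1 + p := ⟨2 * p + 1 - i, by omega⟩
    rw [map_sub, Polynomial.coeff_coe, coeff_expPadeNum, sub_eq_zero, PowerSeries.coeff_mul,
      Finset.Nat.sum_antidiagonal_eq_sum_range_succ_mk,
      ← alternating_sum_choose_mul_choose (p + 1) p d i hd, Finset.sum_mul, Finset.sum_div]
    simp only [Polynomial.coeff_coe, PowerSeries.coeff_exp, coeff_expPadeDen]
    have hterm : ∀ j, j ≤ i →
        (-1 : ℝ) ^ j * ((p + 1).choose j : ℝ) * ((2 * p + 1 - j).factorial : ℝ) /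
            ((2 * p + 1).factorial : ℝ) * (algebraMap ℚ ℝ) (1 / ((i - j).factorial : ℚ)) =
          (-1 : ℝ) ^ j * ((p + 1).choose j : ℝ) * ((p + 1 + p - j).choose d : ℝ) *
            ((2 * p + 1 - i).factorial : ℝ) / ((2 * p + 1).factorial : ℝ) := by
      intro j hj
      have h := Nat.choose_mul_factorial_mul_factorial (n := 2 * p + 1 - j) (k := d) (by omega)
      rw [show 2 * p + 1 - j - d = i - j by omega] at h
      rw [show p + 1 + p - j = 2 * p + 1 - j by omega, show 2 * p + 1 - i = d by omega, ← h]
      have : ((i - j).factorial : ℝ) ≠ 0 := by positivity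
      push_cast
      field_simp
    rw [Finset.sum_congr rfl fun j hj =>
      hterm j (Nat.lt_succ_iff.mp (Finset.mem_range.mp hj))]
    -- The Cauchy product runs over j ≤ i, the identity over j ≤ p+1; the surplus terms contain a
    -- vanishing binomial.
    rcases le_total i (p + 1) with hip | hip
    · refine Finset.sum_subset (Finset.range_mono (by omega)) fun j hj hj' => ?_
      simp only [Finset.mem_range] at hj hj'
      rw [Nat.choose_eq_zero_of_lt (by omega : p + 1 + p - j < d)]
      simp
    · refine (Finset.sum_subset (Finset.range_mono (by omega)) fun j hj hj' => ?_).symm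
      simp only [Finset.mem_range] at hj hj'
      rw [Nat.choose_eq_zero_of_lt (by omega : p + 1 < j)]
      simp

/-! ### Uniqueness -/

/-- A nonzero form `Q e ^ z - P` with `deg P < k`, `deg Q ≤ n` has order at most `k + n` at `0`. -/
theorem eq_zero_of_X_pow_dvd_mul_exp_sub (k n : ℕ) (P Q : ℝ[X]) (hP : P.degree < k)
    (hQ : Q.natDegree ≤ n)
    (h : (PowerSeries.X : ℝ⟦X⟧) ^ (k + n + 1) ∣ (Q : ℝ⟦X⟧) * PowerSeries.exp ℝ - (P : ℝ⟦X⟧)) :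
    Q = 0 := by
  induction k generalizing P Q with
  | zero =>
    have hP0 : P = 0 := by
      rw [← Polynomial.degree_eq_bot, ← Nat.WithBot.lt_zero_iff]
      simpa using hP
    rw [hP0, Polynomial.coe_zero, sub_zero, (PowerSeries.isUnit_exp ℝ).dvd_mul_right] at h
    ext i
    rcases lt_or_ge i (n + 1) with hi | hi
    · have := PowerSeries.X_pow_dvd_iff.mp h i (by omega)
      simpa using this
    · simpa using Polynomial.coeff_eq_zero_of_natDegree_lt (by omega)
  | succ k ih =>
    -- Differentiating gives (Q + Q')e^z - P': the order and the bound on deg P drop by one, the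
    -- bound on deg Q stays. Then Q = -Q', which forces Q = 0 by degree.
    have hsum : Q + Polynomial.derivative Q = 0 := by
      refine ih (Polynomial.derivative P) (Q + Polynomial.derivative Q) ?_ ?_ ?_
      · rw [Polynomial.degree_lt_iff_coeff_zero] at hP ⊢
        intro i hi
        rw [Polynomial.coeff_derivative, hP (i + 1) (by omega), zero_mul]
      · refine (Polynomial.natDegree_add_le _ _).trans (max_le hQ ?_)
        exact (Polynomial.natDegree_derivative_le Q).trans (by omega)
      · rw [PowerSeries.X_pow_dvd_iff] at h ⊢
        intro i hi
        have h1 := h (i + 1) (by omega)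
        have h2 : PowerSeries.coeff i (PowerSeries.derivative ℝ
            ((Q : ℝ⟦X⟧) * PowerSeries.exp ℝ - (P : ℝ⟦X⟧))) = 0 := by
          rw [PowerSeries.coeff_derivative, h1, zero_mul]
        rw [← h2]
        simp [PowerSeries.derivative_coe, PowerSeries.derivative_exp, add_mul,
          mul_comm (PowerSeries.exp ℝ)]
    by_contra hQ0
    have hlt := Polynomial.degree_derivative_lt hQ0
    rw [eq_neg_of_add_eq_zero_right hsum, Polynomial.degree_neg] at hlt
    exact lt_irrefl _ hlt

/-- The Padé approximations of the exponential function of subdiagonal type are unique. -/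
theorem IsPadeApproximation.unique_exp {p : ℕ} {P Q P' Q' : ℝ[X]}
    (h : IsPadeApproximation (PowerSeries.exp ℝ) p (p + 1) P Q)
    (h' : IsPadeApproximation (PowerSeries.exp ℝ) p (p + 1) P' Q') : P = P' ∧ Q = Q' := by
  have hdvd : (PowerSeries.X : ℝ⟦X⟧) ^ (p + (p + 1) + 1) ∣
      ((Q - Q' : ℝ[X]) : ℝ⟦X⟧) * PowerSeries.exp ℝ - ((P - P' : ℝ[X]) : ℝ⟦X⟧) := by
    have := dvd_sub h.order h'.order
    convert this using 1
    simp only [Polynomial.coe_sub]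
    ring
  have hQ0 : (Q - Q').coeff 0 = 0 := by
    rw [Polynomial.coeff_zero_eq_eval_zero, Polynomial.eval_sub, h.den_eval_zero,
      h'.den_eval_zero, sub_self]
  have hP0 : (P - P').coeff 0 = 0 := by
    have := PowerSeries.X_pow_dvd_iff.mp hdvd 0 (by omega)
    simp only [map_sub, PowerSeries.coeff_mul, Finset.Nat.antidiagonal_zero, Finset.sum_singleton,
      Polynomial.coeff_coe, hQ0, zero_mul, zero_sub, neg_eq_zero] at this
    exact this
  -- The normalization makes both differences divisible by X; cancelling X leaves exactly the order
  -- 2p+1 needed with k = n = p.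
  obtain ⟨Q₁, hQ₁⟩ := Polynomial.X_dvd_iff.mpr hQ0
  obtain ⟨P₁, hP₁⟩ := Polynomial.X_dvd_iff.mpr hP0
  have hQz : Q₁ = 0 := by
    refine eq_zero_of_X_pow_dvd_mul_exp_sub p p P₁ Q₁ ?_ ?_ ?_
    · rw [Polynomial.degree_lt_iff_coeff_zero]
      intro i hi
      rw [← Polynomial.coeff_X_mul, ← hP₁]
      exact Polynomial.coeff_eq_zero_of_natDegree_lt (lt_of_le_of_lt
        ((Polynomial.natDegree_sub_le _ _).trans (max_le h.natDegree_num_le h'.natDegree_num_le))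
        (by omega))
    · refine Polynomial.natDegree_le_iff_coeff_eq_zero.mpr fun i hi => ?_
      rw [← Polynomial.coeff_X_mul, ← hQ₁]
      exact Polynomial.coeff_eq_zero_of_natDegree_lt (lt_of_le_of_lt
        ((Polynomial.natDegree_sub_le _ _).trans (max_le h.natDegree_den_le h'.natDegree_den_le))
        (by omega))
    · rw [hQ₁, hP₁, Polynomial.coe_mul, Polynomial.coe_mul, Polynomial.coe_X, mul_assoc,
        ← mul_sub, show p + (p + 1) + 1 = (p + p + 1) + 1 by ring, pow_succ'] at hdvd
      exact (mul_dvd_mul_iff_left PowerSeries.X_ne_zero).mp hdvd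
  have hQQ : Q = Q' := by
    rw [← sub_eq_zero, hQ₁, hQz, mul_zero]
  refine ⟨?_, hQQ⟩
  ext i
  rcases lt_or_ge p i with hi | hi
  · rw [Polynomial.coeff_eq_zero_of_natDegree_lt (h.natDegree_num_le.trans_lt hi),
      Polynomial.coeff_eq_zero_of_natDegree_lt (h'.natDegree_num_le.trans_lt hi)]
  · have := PowerSeries.X_pow_dvd_iff.mp hdvd i (by omega)
    rw [hQQ] at this
    exact (by simpa [sub_eq_zero] using this : P'.coeff i = P.coeff i).symm

/-! ### Integral representations -/

theorem integrableOn_exp_neg_mul_pow (k : ℕ) :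
    MeasureTheory.IntegrableOn (fun s : ℝ => Real.exp (-s) * s ^ k) (Set.Ioi 0) := by
  have h := Real.GammaIntegral_convergent (s := (k : ℝ) + 1) (by positivity)
  simpa using h

theorem integral_exp_neg_mul_pow (k : ℕ) :
    ∫ s in Set.Ioi (0 : ℝ), Real.exp (-s) * s ^ k = (k.factorial : ℝ) := by
  rw [← Real.Gamma_nat_eq_factorial, Real.Gamma_eq_integral (by positivity)]
  simp

theorem exp_neg_mul_pow_mul_add_pow (a b : ℕ) (y s : ℝ) :
    Real.exp (-s) * (s ^ a * (s + y) ^ b) =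
      ∑ j ∈ Finset.range (b + 1),
        ((b.choose j : ℝ) * y ^ j) * (Real.exp (-s) * s ^ (a + b - j)) := by
  rw [add_comm s y, add_pow, Finset.mul_sum, Finset.mul_sum]
  refine Finset.sum_congr rfl fun j hj => ?_
  have hj' : j ≤ b := Nat.lt_succ_iff.mp (Finset.mem_range.mp hj)
  rw [Nat.add_sub_assoc hj', pow_add]
  ring

theorem integrableOn_exp_neg_mul_pow_mul_add_pow (a b : ℕ) (y : ℝ) :
    MeasureTheory.IntegrableOn (fun s : ℝ => Real.exp (-s) * (s ^ a * (s + y) ^ b))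
      (Set.Ioi 0) := by
  simp only [exp_neg_mul_pow_mul_add_pow]
  exact MeasureTheory.integrable_finsetSum _ fun j _ =>
    (integrableOn_exp_neg_mul_pow _).const_mul _

theorem integral_exp_neg_mul_pow_mul_add_pow (a b : ℕ) (y : ℝ) :
    ∫ s in Set.Ioi (0 : ℝ), Real.exp (-s) * (s ^ a * (s + y) ^ b) =
      ∑ j ∈ Finset.range (b + 1), ((b.choose j : ℝ) * y ^ j) * ((a + b - j).factorial : ℝ) := by
  simp only [exp_neg_mul_pow_mul_add_pow]
  rw [MeasureTheory.integral_finsetSum _ fun j _ =>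
    (integrableOn_exp_neg_mul_pow _).const_mul _]
  simp only [MeasureTheory.integral_const_mul, integral_exp_neg_mul_pow]

theorem eval_neg_expPadeNum (p : ℕ) (x : ℝ) :
    (expPadeNum p).eval (-x) =
      (∫ s in Set.Ioi (0 : ℝ), Real.exp (-s) * (s ^ (p + 1) * (s + -x) ^ p)) /
        ((2 * p + 1).factorial : ℝ) := by
  rw [integral_exp_neg_mul_pow_mul_add_pow, expPadeNum, Polynomial.eval_finsetSum, Finset.sum_div]
  refine Finset.sum_congr rfl fun j _ => ?_
  rw [show p + 1 + p - j = 2 * p + 1 - j by omega]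
  simp only [Polynomial.eval_mul, Polynomial.eval_C, Polynomial.eval_pow, Polynomial.eval_X]
  ring

theorem eval_neg_expPadeDen (p : ℕ) (x : ℝ) :
    (expPadeDen p).eval (-x) =
      (∫ s in Set.Ioi (0 : ℝ), Real.exp (-s) * (s ^ p * (s + x) ^ (p + 1))) /
        ((2 * p + 1).factorial : ℝ) := by
  rw [integral_exp_neg_mul_pow_mul_add_pow, expPadeDen, Polynomial.eval_finsetSum, Finset.sum_div]
  refine Finset.sum_congr rfl fun j _ => ?_
  rw [show p + (p + 1) - j = 2 * p + 1 - j by omega]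
  simp only [Polynomial.eval_mul, Polynomial.eval_C, Polynomial.eval_pow, Polynomial.eval_X]
  have : x ^ j = (-1) ^ j * (-x) ^ j := by rw [← mul_pow]; ring
  rw [this]
  ring

theorem eval_neg_expPadeDen_pos (p : ℕ) {x : ℝ} (hx : 0 ≤ x) : 0 < (expPadeDen p).eval (-x) := by
  rw [eval_neg_expPadeDen, integral_exp_neg_mul_pow_mul_add_pow]
  refine div_pos (Finset.sum_pos' (fun j _ => by positivity)
    ⟨0, Finset.mem_range.mpr (by omega), ?_⟩) (by positivity)
  simp only [pow_zero, Nat.choose_zero_right]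
  positivity

/-! ### Pointwise comparison of the integrands -/

theorem mul_pow_sub_le_mul_pow_add (p : ℕ) {x s : ℝ} (hx : 0 ≤ x) (hs : 0 ≤ s) :
    s ^ (p + 1) * (s + -x) ^ p ≤ s ^ p * (s + x) ^ (p + 1) := by
  have h : (s + -x) ^ p ≤ (s + x) ^ p := by
    refine (le_abs_self _).trans ?_
    rw [abs_pow]
    exact pow_le_pow_left₀ (abs_nonneg _) (abs_le.mpr ⟨by linarith, by linarith⟩) _
  calc s ^ (p + 1) * (s + -x) ^ p ≤ s ^ (p + 1) * (s + x) ^ p := by gcongr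
    _ = s ^ p * (s * (s + x) ^ p) := by ring
    _ ≤ s ^ p * ((s + x) * (s + x) ^ p) := by gcongr; linarith
    _ = s ^ p * (s + x) ^ (p + 1) := by ring

/-- Only odd p matters. There |s-x| ≤ s+x reduces the claim to (s+x)² + 8s(s-x) = (3s-x)² ≥ 0; the
constant 8 is the largest for which this quadratic form stays nonnegative. -/
theorem neg_mul_pow_add_le_mul_pow_sub (p : ℕ) {x s : ℝ} (hx : 0 ≤ x) (hs : 0 ≤ s) :
    -(s ^ p * (s + x) ^ (p + 1)) ≤ 8 * (s ^ (p + 1) * (s + -x) ^ p) := by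
  rcases Nat.even_or_odd p with hp | ⟨q, rfl⟩
  · have h1 : 0 ≤ (s + -x) ^ p := hp.pow_nonneg _
    have h2 : 0 ≤ s ^ p * (s + x) ^ (p + 1) := by positivity
    have h3 : 0 ≤ s ^ (p + 1) * (s + -x) ^ p := by positivity
    linarith
  · have h1 : ((s + -x) ^ 2) ^ q ≤ ((s + x) ^ 2) ^ q := by
      refine pow_le_pow_left₀ (sq_nonneg _) ?_ _
      nlinarith [mul_nonneg hs hx]
    have h2 : 0 ≤ ((s + -x) ^ 2) ^ q := by positivity
    have h3 : 0 ≤ (s + x) ^ 2 + 8 * s * (s + -x) := by nlinarith [sq_nonneg (3 * s - x)]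
    have h4 : 0 ≤ ((s + x) ^ 2) ^ q * (s + x) ^ 2 + 8 * s * (s + -x) * ((s + -x) ^ 2) ^ q := by
      nlinarith [mul_nonneg h2 h3, mul_nonneg (sub_nonneg.mpr h1) (sq_nonneg (s + x))]
    have h5 := mul_nonneg (pow_nonneg hs (2 * q + 1)) h4
    have h6 : s ^ (2 * q + 1) *
        (((s + x) ^ 2) ^ q * (s + x) ^ 2 + 8 * s * (s + -x) * ((s + -x) ^ 2) ^ q) =
        s ^ (2 * q + 1) * (s + x) ^ (2 * q + 1 + 1) +
          8 * (s ^ (2 * q + 1 + 1) * (s + -x) ^ (2 * q + 1)) := by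
      simp only [← pow_mul]
      ring
    linarith

theorem eval_neg_expPadeNum_le (p : ℕ) {x : ℝ} (hx : 0 ≤ x) :
    (expPadeNum p).eval (-x) ≤ (expPadeDen p).eval (-x) := by
  rw [eval_neg_expPadeNum, eval_neg_expPadeDen]
  refine div_le_div_of_nonneg_right ?_ (by positivity)
  refine MeasureTheory.setIntegral_mono_on (integrableOn_exp_neg_mul_pow_mul_add_pow _ _ _)
    (integrableOn_exp_neg_mul_pow_mul_add_pow _ _ _) measurableSet_Ioi fun s hs => ?_
  exact mul_le_mul_of_nonneg_left (mul_pow_sub_le_mul_pow_add p hx (le_of_lt hs))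
    (Real.exp_pos _).le

theorem neg_eval_neg_expPadeDen_le (p : ℕ) {x : ℝ} (hx : 0 ≤ x) :
    -(expPadeDen p).eval (-x) ≤ 8 * (expPadeNum p).eval (-x) := by
  rw [eval_neg_expPadeNum, eval_neg_expPadeDen, ← mul_div_assoc, ← neg_div]
  refine div_le_div_of_nonneg_right ?_ (by positivity)
  rw [← MeasureTheory.integral_neg, ← MeasureTheory.integral_const_mul]
  refine MeasureTheory.setIntegral_mono_on (integrableOn_exp_neg_mul_pow_mul_add_pow _ _ _).neg
    ((integrableOn_exp_neg_mul_pow_mul_add_pow _ _ _).const_mul _) measurableSet_Ioi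
    fun s hs => ?_
  have := mul_le_mul_of_nonneg_left (neg_mul_pow_add_le_mul_pow_sub p hx (le_of_lt hs))
    (Real.exp_pos (-s)).le
  linarith

/-! ### The smoothing bound -/

theorem spatialSymbol_nonneg (θ : ℝ) : 0 ≤ spatialSymbol θ := by
  have h1 := Real.cos_le_one θ
  have h2 := Real.neg_one_le_cos θ
  exact mul_nonneg (by norm_num) (div_nonneg (by linarith) (by linarith))

theorem smoothingSymbol_half_le {α θ : ℝ} (hα : -(1 / 8) ≤ α) (hα' : α ≤ 1)
    (hθ : Real.cos θ ≤ 0) : smoothingSymbol (1 / 2) α θ ≤ 1 / Real.sqrt 2 := by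
  rw [smoothingSymbol, one_div (Real.sqrt 2), ← Real.sqrt_inv]
  refine Real.sqrt_le_sqrt ?_
  have h := Real.neg_one_le_cos θ
  rcases le_total 0 α with h0 | h0
  · nlinarith [mul_nonneg h0 (neg_nonneg.mpr hθ)]
  · nlinarith [mul_nonneg (neg_nonneg.mpr h0) (by linarith : 0 ≤ 1 + Real.cos θ)]

theorem mainTheorem1 (p : ℕ) (P Q : Polynomial ℝ)
    (hR : IsPadeApproximation (PowerSeries.exp ℝ) p (p + 1) P Q) (μ : ℝ) (hμ : 0 ≤ μ) :
    (∀ θx ∈ Set.Icc 0 Real.pi, Q.eval (-μ * spatialSymbol θx) ≠ 0) ∧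
      BddAbove (semiCoarseningValues P Q (1 / 2) μ) ∧
      sSup (semiCoarseningValues P Q (1 / 2) μ) ≤ 1 / Real.sqrt 2 := by
  obtain ⟨rfl, rfl⟩ := hR.unique_exp (isPadeApproximation_expPade p)
  have hx : ∀ θ, 0 ≤ μ * spatialSymbol θ := fun θ => mul_nonneg hμ (spatialSymbol_nonneg θ)
  have hbound : ∀ s ∈ semiCoarseningValues (expPadeNum p) (expPadeDen p) (1 / 2) μ,
      s ≤ 1 / Real.sqrt 2 := by
    rintro s ⟨θt, hθt, θx, -, rfl⟩
    have hpos := eval_neg_expPadeDen_pos p (hx θx)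
    have hcos : Real.cos θt ≤ 0 :=
      Real.cos_nonpos_of_pi_div_two_le_of_le hθt.1 (by linarith [hθt.2, Real.pi_pos])
    refine smoothingSymbol_half_le ?_ ?_ hcos
    · rw [stabilityValue, neg_mul, le_div_iff₀ hpos]
      linarith [neg_eval_neg_expPadeDen_le p (hx θx)]
    · rw [stabilityValue, neg_mul, div_le_one hpos]
      exact eval_neg_expPadeNum_le p (hx θx)
  refine ⟨fun θ _ => ?_, ⟨_, hbound⟩, Real.sSup_le hbound (by positivity)⟩
  rw [neg_mul]
  exact (eval_neg_expPadeDen_pos p (hx θ)).ne'
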